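/- **Universality of random feature neural networks.** Let $d\in\mathbb{N}$, let $K\subseteq\mathbb{R}^d$ be compact and let $f:K\to\mathbb{R}$ be continuous. Let $\sigma:\mathbb{R}\to\mathbb{R}$ be continuous and not a polynomial function, and let $\mu$ be a continuous (that is, atomless) probability distribution on $\mathbb{R}$ with full support, meaning that every non-empty open subset of $\mathbb{R}$ has positive $\mu$-measure. Then for every $\alpha\in(0,1)$ and every $\varepsilon>0$ there is an integer $M\ge 1$ with the following property. Let $A$ be an $\mathbb{R}^{M\times d}$-valued random matrix and $\xi$ an $\mathbb{R}^M$-valued random vector on a common probability space, such that all the $Md+M$ entries of $A$ and $\xi$ together are independent and each has distribution $\mu$. Then, with probability greater than $\alpha$, there exists a vector $w\in\mathbb{R}^M$ (depending on the realisation of $A$ and $\xi$) such that the random feature neural network $$\Psi^{A,\xi}_w:K\to\mathbb{R},\qquad \Psi^{A,\xi}_w(x)=w^T\sigma(Ax+\xi),$$ with $\sigma$ applied componentwise, satisfies $\Vert f-\Psi^{A,\xi}_w\Vert_\infty<\varepsilon$, where $\Vert\cdot\Vert_\infty$ is the supremum norm on $K$. -/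

import Mathlib

open MeasureTheory ProbabilityTheory
open scoped Matrix

/-- The neural network `x ↦ wᵀ σ(A x + ξ)` with one hidden layer of width `M` and inputs in `ℝ^d`;
the activation function `σ` is applied componentwise. -/
def featureNetwork {M d : ℕ} (σ : ℝ → ℝ) (A : Matrix (Fin M) (Fin d) ℝ) (ξ w : Fin M → ℝ)
    (x : Fin d → ℝ) : ℝ :=
  w ⬝ᵥ fun i => σ ((A *ᵥ x + ξ) i)

theorem continuous_featureNetwork {M d : ℕ} {σ : ℝ → ℝ} (hσ : Continuous σ)
    (A : Matrix (Fin M) (Fin d) ℝ) (ξ w : Fin M → ℝ) :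
    Continuous (featureNetwork σ A ξ w) := by
  have h : Continuous fun x : Fin d → ℝ => A *ᵥ x + ξ :=
    (continuous_const.matrix_mulVec continuous_id).add continuous_const
  exact continuous_const.dotProduct
    (continuous_pi fun i => hσ.comp ((continuous_apply i).comp h))

/-- The network restricted to a compact set `K`, as an element of the space `C(K, ℝ)`, whose norm
is the supremum norm on `K`. -/
def featureNetworkOn {M d : ℕ} (K : TopologicalSpace.Compacts (Fin d → ℝ)) {σ : ℝ → ℝ}
    (hσ : Continuous σ) (A : Matrix (Fin M) (Fin d) ℝ) (ξ w : Fin M → ℝ) : C(K, ℝ) where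
  toFun x := featureNetwork σ A ξ w x
  continuous_toFun := (continuous_featureNetwork hσ A ξ w).comp continuous_subtype_val

/-- The function `σ` is (globally) given by a real polynomial. -/
def IsPolynomialFunction (σ : ℝ → ℝ) : Prop :=
  ∃ p : Polynomial ℝ, ∀ t : ℝ, σ t = p.eval t

/-- The family of all `M * d + M` scalar entries of a random matrix `A` and a random vector `ξ`. -/
def randomEntries {Ω : Type*} {M d : ℕ} (A : Ω → Matrix (Fin M) (Fin d) ℝ)
    (ξ : Ω → Fin M → ℝ) : (Fin M × Fin d) ⊕ Fin M → Ω → ℝ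
  | Sum.inl p => fun ω => A ω p.1 p.2
  | Sum.inr i => fun ω => ξ ω i

/-- All entries of `A` and `ξ` together are independent random variables on the probability space
`(Ω, P)`, each with law `μ`. -/
structure HasIIDEntries {Ω : Type*} [MeasurableSpace Ω] {M d : ℕ}
    (A : Ω → Matrix (Fin M) (Fin d) ℝ) (ξ : Ω → Fin M → ℝ)
    (μ : Measure ℝ) (P : Measure Ω) : Prop where
  hasLaw : ∀ k, HasLaw (randomEntries A ξ k) μ P
  indep : iIndepFun (randomEntries A ξ) P

/-! By Hahn–Banach, the ridge functions σ(a·x + b) span a dense subspace of C(K) once every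
continuous functional ℓ killing them is zero. Such an ℓ also kills the ridge functions of
mollifications of σ. Differentiating k times in the dilation s, at s = 0, leaves a multiple of
ℓ((a·x)^k). For a suitable mollifier and b the factor is nonzero: otherwise σ would be a pointwise
limit of polynomials of degree below k. Hence ℓ kills every exp(a·x), and these have dense span by
Stone–Weierstrass, so ℓ = 0 (`exists_sum_ridgeOn_lt`). An approximant with N features survives small
moves of its parameters. By full support each of the N parameter boxes has positive probability, so
M independent rows hit all of them with probability tending to 1
(`exists_lt_pi_forall_exists_row_mem`). Rows that are not selected get weight 0. -/

/-! ### Polynomials and mollification -/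

section Polynomial

/-- A smooth function whose `k`-th derivative vanishes is a polynomial of degree less than `k`. -/
theorem exists_polynomial_of_iteratedDeriv_eq_zero (k : ℕ) :
    ∀ g : ℝ → ℝ, ContDiff ℝ (⊤ : ℕ∞) g → (∀ t, iteratedDeriv k g t = 0) →
      ∃ p : Polynomial ℝ, p.degree < k ∧ ∀ t, g t = p.eval t := by
  intro g hg h0
  rcases k with _ | n
  · exact ⟨0, by simp, by simpa using h0⟩
  refine ⟨∑ i ∈ Finset.range (n + 1),
    Polynomial.C (iteratedDeriv i g 0 / (i.factorial : ℝ)) * Polynomial.X ^ i, ?_, fun t => ?_⟩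
  · refine (Polynomial.degree_sum_le _ _).trans_lt ((Finset.sup_lt_iff ?_).2 fun i hi => ?_)
    · exact WithBot.bot_lt_coe _
    · refine (Polynomial.degree_C_mul_X_pow_le _ _).trans_lt ?_
      exact_mod_cast Finset.mem_range.1 hi
  · rcases eq_or_ne t 0 with rfl | ht
    · simp [Polynomial.eval_finsetSum, Finset.sum_range_succ']
    -- The Lagrange remainder of order n carries the factor `iteratedDeriv (n + 1) g x'`, which is
    -- 0.
    · obtain ⟨x', -, hx'⟩ := taylor_mean_remainder_lagrange_iteratedDeriv (f := g) (x := t)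
        (x₀ := 0) (n := n) ht.symm (hg.of_le (by exact_mod_cast le_top)).contDiffOn
      rw [h0, zero_mul, zero_div, sub_eq_zero] at hx'
      rw [hx', taylor_within_apply, Polynomial.eval_finsetSum]
      refine Finset.sum_congr rfl fun i hi => ?_
      rw [iteratedDerivWithin_eq_iteratedDeriv (uniqueDiffOn_uIcc ht.symm)
        (hg.of_le (by exact_mod_cast le_top)).contDiffAt Set.left_mem_uIcc]
      simp
      ring

/-- Pointwise limits of polynomials of bounded degree are polynomials. -/
theorem isPolynomialFunction_of_tendsto {σ : ℝ → ℝ} {k : ℕ} {p : ℕ → Polynomial ℝ}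
    (hdeg : ∀ n, (p n).degree < k)
    (hlim : ∀ t, Filter.Tendsto (fun n => (p n).eval t) Filter.atTop (nhds (σ t))) :
    IsPolynomialFunction σ := by
  have hinj : Set.InjOn (fun i : ℕ => (i : ℝ)) (Finset.range k : Set ℕ) :=
    Nat.cast_injective.injOn
  refine ⟨Lagrange.interpolate (Finset.range k) (fun i : ℕ => (i : ℝ)) fun i => σ i, fun t => ?_⟩
  refine tendsto_nhds_unique (hlim t) ?_
  -- Degree below k means each polynomial is recovered from its values at 0, …, k - 1 by a finite
  -- formula, which passes to the limit.
  have h : ∀ n, (p n).eval t = ∑ i ∈ Finset.range k,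
      (p n).eval (i : ℝ) * (Lagrange.basis (Finset.range k) (fun i : ℕ => (i : ℝ)) i).eval t := by
    intro n
    conv_lhs => rw [Lagrange.eq_interpolate (f := p n) hinj (by simpa using hdeg n)]
    simp [Lagrange.interpolate_apply, Polynomial.eval_finsetSum]
  simp_rw [h, Lagrange.interpolate_apply, Polynomial.eval_finsetSum, Polynomial.eval_mul,
    Polynomial.eval_C]
  exact tendsto_finsetSum _ fun i _ => (hlim i).mul_const _

open scoped Convolution in
/-- Mollifying a continuous non-polynomial function gives, for every order, a function with a
non-vanishing derivative of that order. -/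
theorem exists_iteratedDeriv_convolution_ne_zero {σ : ℝ → ℝ} (hσ : Continuous σ)
    (hσ_poly : ¬ IsPolynomialFunction σ) (k : ℕ) :
    ∃ (φ : ContDiffBump (0 : ℝ)) (b : ℝ),
      iteratedDeriv k (φ.normed volume ⋆[ContinuousLinearMap.lsmul ℝ ℝ, volume] σ) b ≠ 0 := by
  by_contra! h
  -- Radii shrinking to 0 give mollifications that converge to σ pointwise; the degree bound k does
  -- not depend on n.
  let φ : ℕ → ContDiffBump (0 : ℝ) := fun n =>
    { rIn := 1 / ((n : ℝ) + 1), rOut := 2 * (1 / ((n : ℝ) + 1))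
      rIn_pos := by positivity
      rIn_lt_rOut := by linarith [Nat.one_div_pos_of_nat (α := ℝ) (n := n)] }
  have hp := fun n => exists_polynomial_of_iteratedDeriv_eq_zero k _
    ((φ n).hasCompactSupport_normed.contDiff_convolution_left
      (ContinuousLinearMap.lsmul ℝ ℝ) ((φ n).contDiff_normed (n := (⊤ : ℕ∞)))
      (hσ.locallyIntegrable (μ := volume))) (h (φ n))
  choose p hdeg hp using hp
  refine hσ_poly (isPolynomialFunction_of_tendsto hdeg fun t => ?_)
  simp_rw [← hp]
  refine ContDiffBump.convolution_tendsto_right_of_continuous ?_ hσ t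
  simpa [φ] using (tendsto_one_div_add_atTop_nhds_zero_nat (𝕜 := ℝ)).const_mul 2

end Polynomial

/-! ### Functionals annihilating ridge functions -/

section Functional

variable {X : Type*} [TopologicalSpace X]

/-- The function `x ↦ y(x)^k g(s y(x) + b)`. -/
def powMulComp (g : C(ℝ, ℝ)) (y : C(X, ℝ)) (b : ℝ) (k : ℕ) (s : ℝ) : C(X, ℝ) :=
  y ^ k * g.comp (s • y + ContinuousMap.const X b)

@[simp]
theorem powMulComp_apply (g : C(ℝ, ℝ)) (y : C(X, ℝ)) (b : ℝ) (k : ℕ) (s : ℝ) (x : X) :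
    powMulComp g y b k s x = y x ^ k * g (s * y x + b) := by
  simp [powMulComp]

theorem continuous_powMulComp (g : C(ℝ, ℝ)) (y : C(X, ℝ)) (b : ℝ) (k : ℕ) :
    Continuous (powMulComp g y b k) := by
  let F : C(ℝ × X, ℝ) := ⟨fun p => y p.2 ^ k * g (p.1 * y p.2 + b), by fun_prop⟩
  have h : powMulComp g y b k = F.curry := by
    ext s x
    simp [F]
  rw [h]
  exact F.curry.continuous

variable [CompactSpace X]

/-- The derivative is needed in the sup norm, not just pointwise. Pointwise, the curve is the
integral of its derivative; that derivative is continuous into `C(X, ℝ)`, so the fundamental theorem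
of calculus applies there. -/
theorem hasDerivAt_powMulComp {g g' : C(ℝ, ℝ)} (hg : ∀ t, HasDerivAt g (g' t) t) (y : C(X, ℝ))
    (b : ℝ) (k : ℕ) (s : ℝ) :
    HasDerivAt (powMulComp g y b k) (powMulComp g' y b (k + 1) s) s := by
  have hc := continuous_powMulComp g' y b (k + 1)
  have h : powMulComp g y b k = fun s =>
      powMulComp g y b k 0 + ∫ u in (0 : ℝ)..s, powMulComp g' y b (k + 1) u := by
    ext s x
    have h1 : (∫ u in (0 : ℝ)..s, powMulComp g' y b (k + 1) u) x =
        ∫ u in (0 : ℝ)..s, powMulComp g' y b (k + 1) u x :=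
      ((ContinuousMap.evalCLM ℝ x).intervalIntegral_comp_comm (hc.intervalIntegrable 0 s)).symm
    have h2 : ∀ u, HasDerivAt (fun u => powMulComp g y b k u x)
        (powMulComp g' y b (k + 1) u x) u := by
      intro u
      simp only [powMulComp_apply]
      have := ((hg (u * y x + b)).comp u
        (((hasDerivAt_id u).mul_const (y x)).add_const b)).const_mul (y x ^ k)
      refine this.congr_deriv ?_
      simp only [one_mul]
      ring
    rw [ContinuousMap.add_apply, h1, intervalIntegral.integral_eq_sub_of_hasDerivAt
      (fun u _ => h2 u) ?_]
    · ring
    · exact ((continuous_eval_const x).comp hc).intervalIntegrable 0 s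
  rw [h]
  exact (intervalIntegral.integral_hasDerivAt_right (hc.intervalIntegrable 0 s)
    (hc.stronglyMeasurableAtFilter _ _) hc.continuousAt).const_add _

/-- A functional vanishing on all dilates of a smooth ridge function vanishes on their derivatives
with respect to the dilation parameter. -/
theorem map_powMulComp_eq_zero (ℓ : StrongDual ℝ C(X, ℝ)) (y : C(X, ℝ)) (b : ℝ) (g : ℕ → C(ℝ, ℝ))
    (hg : ∀ k t, HasDerivAt (g k) (g (k + 1) t) t) (h : ∀ s, ℓ (powMulComp (g 0) y b 0 s) = 0)
    (k : ℕ) (s : ℝ) : ℓ (powMulComp (g k) y b k s) = 0 := by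
  induction k generalizing s with
  | zero => exact h s
  | succ k ih =>
    have h1 := ℓ.hasFDerivAt.comp_hasDerivAt s (hasDerivAt_powMulComp (hg k) y b k s)
    have h2 : (ℓ ∘ powMulComp (g k) y b k) = fun _ => 0 := funext ih
    rw [h2] at h1
    exact h1.unique (hasDerivAt_const s 0)

open scoped Convolution in
/-- A functional vanishing on all `σ(s y + b)` vanishes on all `(φ ⋆ σ)(s y + b)`. -/
theorem map_powMulComp_convolution_eq_zero (ℓ : StrongDual ℝ C(X, ℝ)) (y : C(X, ℝ)) (σ : C(ℝ, ℝ))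
    (h : ∀ s b, ℓ (powMulComp σ y b 0 s) = 0) {φ : ℝ → ℝ} (hφ : Continuous φ)
    (hφc : HasCompactSupport φ) (G : C(ℝ, ℝ))
    (hG : ⇑G = φ ⋆[ContinuousLinearMap.lsmul ℝ ℝ, volume] σ) (s b : ℝ) :
    ℓ (powMulComp G y b 0 s) = 0 := by
  have hc : Continuous fun t : ℝ => φ t • powMulComp σ y (b - t) 0 s := by
    refine hφ.smul ?_
    let F : C(ℝ × X, ℝ) := ⟨fun p => σ (s * y p.2 + (b - p.1)), by fun_prop⟩
    have hF : (fun t : ℝ => powMulComp σ y (b - t) 0 s) = F.curry := by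
      ext t x
      simp [F]
    rw [hF]
    exact F.curry.continuous
  have hi : Integrable (fun t : ℝ => φ t • powMulComp σ y (b - t) 0 s) :=
    hc.integrable_of_hasCompactSupport hφc.smul_right
  have he : powMulComp G y b 0 s = ∫ t : ℝ, φ t • powMulComp σ y (b - t) 0 s := by
    ext x
    have h1 : (∫ t : ℝ, φ t • powMulComp σ y (b - t) 0 s) x =
        ∫ t : ℝ, (φ t • powMulComp σ y (b - t) 0 s) x :=
      ((ContinuousMap.evalCLM ℝ x).integral_comp_comm hi).symm
    rw [h1, powMulComp_apply, hG, convolution_def]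
    simp [add_sub_assoc]
  rw [he, ← ℓ.integral_comp_comm hi]
  simp [h]

/-- A functional vanishing on all `σ(s y + b)`, with `σ` not a polynomial, vanishes on powers. -/
theorem map_pow_eq_zero_of_ridge (ℓ : StrongDual ℝ C(X, ℝ)) (y : C(X, ℝ)) (σ : C(ℝ, ℝ))
    (hσ_poly : ¬ IsPolynomialFunction σ) (h : ∀ s b, ℓ (powMulComp σ y b 0 s) = 0) (k : ℕ) :
    ℓ (y ^ k) = 0 := by
  obtain ⟨φ, b, hb⟩ := exists_iteratedDeriv_convolution_ne_zero σ.continuous hσ_poly k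
  have hsm := (φ.hasCompactSupport_normed (μ := volume)).contDiff_convolution_left (μ := volume)
      (ContinuousLinearMap.lsmul ℝ ℝ) (φ.contDiff_normed (μ := volume) (n := (⊤ : ℕ∞)))
      (σ.continuous.locallyIntegrable (μ := volume))
  set G := convolution (φ.normed volume) σ (ContinuousLinearMap.lsmul ℝ ℝ) volume with hG
  let g : ℕ → C(ℝ, ℝ) := fun k =>
    ⟨iteratedDeriv k G, hsm.continuous_iteratedDeriv k (by exact_mod_cast le_top)⟩
  have hg : ∀ k t, HasDerivAt (g k) (g (k + 1) t) t := by
    intro k t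
    change HasDerivAt (iteratedDeriv k G) (iteratedDeriv (k + 1) G t) t
    rw [iteratedDeriv_succ]
    exact ((hsm.differentiable_iteratedDeriv k
      (by exact_mod_cast WithTop.coe_lt_top _)) t).hasDerivAt
  have h0 := map_powMulComp_eq_zero ℓ y b g hg (fun s =>
    map_powMulComp_convolution_eq_zero ℓ y σ h (φ.continuous_normed (μ := volume))
      φ.hasCompactSupport_normed
      (g 0) (by simp [g, hG]) s b) k 0
  -- At s = 0 the argument of the derivative freezes at b, so only a constant times the power
  -- remains.
  have h1 : powMulComp (g k) y b k 0 = iteratedDeriv k G b • y ^ k := by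
    ext x
    simp [g, mul_comm]
  rw [h1, map_smul, smul_eq_mul] at h0
  exact (mul_eq_zero.1 h0).resolve_left hb

theorem map_exp_eq_zero_of_map_pow (ℓ : StrongDual ℝ C(X, ℝ)) (y : C(X, ℝ))
    (h : ∀ k : ℕ, ℓ (y ^ k) = 0) : ℓ (NormedSpace.exp y) = 0 := by
  have h1 := (NormedSpace.exp_series_hasSum_exp' (𝕂 := ℝ) y).mapL ℓ
  simp only [map_smul, h, smul_zero] at h1
  exact h1.unique hasSum_zero

end Functional

/-! ### Density of ridge functions -/

section Density

variable {d : ℕ}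

/-- The ridge function `x ↦ σ(a · x + b)` on `K`, with parameter `(a, b)`. -/
def ridgeOn (K : TopologicalSpace.Compacts (Fin d → ℝ)) (σ : C(ℝ, ℝ)) (θ : (Fin d → ℝ) × ℝ) :
    C(K, ℝ) where
  toFun x := σ (θ.1 ⬝ᵥ (x : Fin d → ℝ) + θ.2)
  continuous_toFun := σ.continuous.comp
    ((continuous_const.dotProduct continuous_subtype_val).add continuous_const)

theorem continuous_ridgeOn (K : TopologicalSpace.Compacts (Fin d → ℝ)) (σ : C(ℝ, ℝ)) :
    Continuous (ridgeOn K σ) := by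
  let F : C(((Fin d → ℝ) × ℝ) × K, ℝ) :=
    ⟨fun p => σ (p.1.1 ⬝ᵥ (p.2 : Fin d → ℝ) + p.1.2), σ.continuous.comp
      ((continuous_fst.fst.dotProduct (continuous_subtype_val.comp continuous_snd)).add
        continuous_fst.snd)⟩
  exact F.curry.continuous

/-- The linear form `x ↦ a · x` on `K`. -/
def linearFormOn (K : TopologicalSpace.Compacts (Fin d → ℝ)) : (Fin d → ℝ) →+ C(K, ℝ) where
  toFun a := ⟨fun x => a ⬝ᵥ (x : Fin d → ℝ), continuous_const.dotProduct continuous_subtype_val⟩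
  map_zero' := by ext; simp
  map_add' a b := by ext; simp [add_dotProduct]

@[simp]
theorem linearFormOn_apply (K : TopologicalSpace.Compacts (Fin d → ℝ)) (a : Fin d → ℝ) (x : K) :
    linearFormOn K a x = a ⬝ᵥ (x : Fin d → ℝ) := rfl

/-- The multiplicative family of the functions `x ↦ exp(a · x)` on `K`. -/
noncomputable def expFormOn (K : TopologicalSpace.Compacts (Fin d → ℝ)) :
    Multiplicative (Fin d → ℝ) →* C(K, ℝ) where
  toFun a := NormedSpace.exp (linearFormOn K a.toAdd)
  map_one' := by simp
  map_mul' a b := by rw [toAdd_mul, map_add, NormedSpace.exp_add]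

theorem expFormOn_apply (K : TopologicalSpace.Compacts (Fin d → ℝ))
    (a : Multiplicative (Fin d → ℝ)) (x : K) :
    expFormOn K a x = Real.exp (a.toAdd ⬝ᵥ (x : Fin d → ℝ)) := by
  have h := NormedSpace.map_exp (ContinuousMap.evalAlgHom ℝ ℝ x)
    (continuous_eval_const x) (linearFormOn K a.toAdd)
  rw [← Real.exp_eq_exp_ℝ] at h
  exact h

/-- A functional vanishing on all exponentials of linear forms is zero. -/
theorem eq_zero_of_map_expFormOn (K : TopologicalSpace.Compacts (Fin d → ℝ))
    (ℓ : StrongDual ℝ C(K, ℝ)) (h : ∀ a, ℓ (expFormOn K a) = 0) : ℓ = 0 := by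
  let S := Algebra.adjoin ℝ (Set.range (expFormOn K))
  have hsep : S.SeparatesPoints := by
    intro x y hxy
    obtain ⟨i, hi⟩ := Function.ne_iff.1 (Subtype.coe_injective.ne hxy)
    refine ⟨_, ⟨expFormOn K (Multiplicative.ofAdd (Pi.single i 1)),
      Algebra.subset_adjoin ⟨_, rfl⟩, rfl⟩, ?_⟩
    simpa [expFormOn_apply] using hi
  have hS : Subalgebra.toSubmodule S ≤ LinearMap.ker (ℓ : C(K, ℝ) →ₗ[ℝ] ℝ) := by
    -- The exponentials are closed under products, so the algebra they generate is just their linear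
    -- span.
    have hcl : (Submonoid.closure (Set.range (expFormOn K)) : Set C(K, ℝ)) =
        Set.range (expFormOn K) := by
      rw [← MonoidHom.coe_mrange, Submonoid.closure_eq]
    rw [Algebra.adjoin_eq_span, hcl, Submodule.span_le]
    rintro _ ⟨a, rfl⟩
    exact h a
  have htop := ContinuousMap.subalgebra_topologicalClosure_eq_top_of_separatesPoints S hsep
  ext f
  have hf : f ∈ closure (S : Set C(K, ℝ)) := by
    rw [← Subalgebra.topologicalClosure_coe, htop]
    trivial
  exact closure_minimal (fun g hg => hS hg) (isClosed_singleton.preimage ℓ.continuous) hf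

/-- **Universal approximation**: finite linear combinations of ridge functions are dense. -/
theorem exists_sum_ridgeOn_lt (K : TopologicalSpace.Compacts (Fin d → ℝ)) (σ : C(ℝ, ℝ))
    (hσ_poly : ¬ IsPolynomialFunction σ) (f : C(K, ℝ)) {ε : ℝ} (hε : 0 < ε) :
    ∃ (N : ℕ) (w : Fin N → ℝ) (θ : Fin N → (Fin d → ℝ) × ℝ),
      ‖f - ∑ j, w j • ridgeOn K σ (θ j)‖ < ε := by
  let V := Submodule.span ℝ (Set.range (ridgeOn K σ))
  have hf : f ∈ closure (V : Set C(K, ℝ)) := by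
    rw [← Submodule.topologicalClosure_coe]
    by_contra hf
    obtain ⟨ℓ, u, hu, huf⟩ := geometric_hahn_banach_closed_point
      V.topologicalClosure.convex V.isClosed_topologicalClosure hf
    -- A functional bounded above on a subspace vanishes there: rescaling g would make it attain the
    -- bound u.
    have hV : ∀ g ∈ V.topologicalClosure, ℓ g = 0 := by
      intro g hg
      by_contra hne
      have := hu ((u / ℓ g) • g) (Submodule.smul_mem _ _ hg)
      rw [map_smul, smul_eq_mul, div_mul_cancel₀ _ hne] at this
      exact lt_irrefl _ this
    have hl : ℓ = 0 := by
      refine eq_zero_of_map_expFormOn K ℓ fun a => ?_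
      refine map_exp_eq_zero_of_map_pow ℓ _ (map_pow_eq_zero_of_ridge ℓ _ σ hσ_poly fun s b => ?_)
      refine hV _ (V.le_topologicalClosure (Submodule.subset_span ⟨(s • a.toAdd, b), ?_⟩))
      ext x
      simp [ridgeOn]
    have := hu 0 (Submodule.zero_mem _)
    simp [hl] at this huf
    linarith
  obtain ⟨g, hg, hfg⟩ := Metric.mem_closure_iff.1 hf ε hε
  obtain ⟨N, w, r, rfl⟩ := (Submodule.mem_span_set' ).1 hg
  choose θ hθ using fun j => (r j).2
  refine ⟨N, w, θ, ?_⟩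
  simpa [hθ, dist_eq_norm] using hfg

/-- The approximating parameters can be moved in small boxes. -/
theorem exists_sum_ridgeOn_lt_of_mem_ball (K : TopologicalSpace.Compacts (Fin d → ℝ)) (σ : C(ℝ, ℝ))
    (hσ_poly : ¬ IsPolynomialFunction σ) (f : C(K, ℝ)) {ε : ℝ} (hε : 0 < ε) :
    ∃ (N : ℕ) (w : Fin N → ℝ) (θ : Fin N → (Fin d → ℝ) × ℝ) (δ : ℝ), 0 < δ ∧
      ∀ θ' : Fin N → (Fin d → ℝ) × ℝ, (∀ j, θ' j ∈ Metric.ball (θ j) δ) →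
        ‖f - ∑ j, w j • ridgeOn K σ (θ' j)‖ < ε := by
  obtain ⟨N, w, θ, h⟩ := exists_sum_ridgeOn_lt K σ hσ_poly f hε
  have ho : IsOpen {θ' : Fin N → (Fin d → ℝ) × ℝ | ‖f - ∑ j, w j • ridgeOn K σ (θ' j)‖ < ε} :=
    isOpen_lt (continuous_const.sub (continuous_finsetSum _ fun j _ =>
      ((continuous_ridgeOn K σ).comp (continuous_apply j)).const_smul (w j))).norm continuous_const
  obtain ⟨δ, hδ, hsub⟩ := Metric.isOpen_iff.1 ho θ h
  exact ⟨N, w, θ, δ, hδ, fun θ' hθ' => hsub ((dist_pi_lt_iff hδ).2 hθ')⟩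

end Density

/-! ### Hitting all boxes with independent rows -/

section Probability

/-- In the product space of `M` rows of entries, the probability that no row lands in a given box
is a power of `M`. -/
theorem pi_forall_row_notMem {M : ℕ} {κ : Type*} [Fintype κ] (μ : Measure ℝ)
    [IsProbabilityMeasure μ] (B : κ → Set ℝ) (hB : ∀ k, MeasurableSet (B k)) {ι : Type*} [Fintype ι]
    (e : Fin M × κ ≃ ι) :
    Measure.pi (fun _ : ι => μ) {z | ∀ i, ¬ ∀ k, z (e (i, k)) ∈ B k} =
      (1 - ∏ k, μ (B k)) ^ M := by
  classical
  let E : Fin M → Set (ι → ℝ) := fun i => {z | ∀ k, z (e (i, k)) ∈ B k}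
  have hE : ∀ i, MeasurableSet (E i) := fun i => by
    simp only [E, Set.ofPred_forall]
    exact MeasurableSet.iInter fun k => measurable_pi_apply _ (hB k)
  -- Intersections of the row events are again boxes, so the product measure factorises and the
  -- events are independent.
  have hmeas : ∀ s : Finset (Fin M), Measure.pi (fun _ : ι => μ) (⋂ i ∈ s, E i) =
      ∏ i ∈ s, ∏ k, μ (B k) := by
    intro s
    have h1 : (⋂ i ∈ s, E i) = Set.univ.pi fun j : ι =>
        if (e.symm j).1 ∈ s then B (e.symm j).2 else Set.univ := by
      ext z
      simp only [E, Set.mem_iInter, Set.mem_ofPred_eq, Set.mem_univ_pi]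
      constructor
      · intro h j
        split_ifs with hj
        · simpa using h _ hj (e.symm j).2
        · trivial
      · intro h i hi k
        simpa [hi] using h (e (i, k))
    rw [h1, Measure.pi_pi, ← e.prod_comp, Fintype.prod_prod_type, ← Finset.prod_subset
      (Finset.subset_univ s)]
    · exact Finset.prod_congr rfl fun i hi => by simp [hi]
    · intro i _ hi
      simp [hi]
  have hprob : ∀ i, Measure.pi (fun _ : ι => μ) (E i) = ∏ k, μ (B k) := fun i => by
    simpa using hmeas {i}
  have hind : iIndepSet E (Measure.pi fun _ : ι => μ) := by
    rw [iIndepSet_iff_meas_biInter hE]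
    intro s
    rw [hmeas]
    simp [hprob]
  have hset : {z : ι → ℝ | ∀ i, ¬ ∀ k, z (e (i, k)) ∈ B k} = ⋂ i, (E i)ᶜ := by
    ext z
    simp [E]
  rw [hset, iIndep.meas_iInter hind fun i =>
    (MeasurableSpace.measurableSet_generateFrom (Set.mem_singleton _)).compl]
  simp [prob_compl_eq_one_sub (hE _), hprob]

/-- If `M` is large, then with probability greater than `α` every one of finitely many boxes of
positive measure is hit by one of the `M` rows. -/
theorem exists_lt_pi_forall_exists_row_mem {N : ℕ} {κ : Type} [Fintype κ] (μ : Measure ℝ)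
    [IsProbabilityMeasure μ] (B : Fin N → κ → Set ℝ) (hB : ∀ j k, MeasurableSet (B j k))
    (hpos : ∀ j k, 0 < μ (B j k)) {α : ℝ} (hα : α < 1) :
    ∃ M : ℕ, 0 < M ∧ ∀ (ι : Type) [Fintype ι] (e : Fin M × κ ≃ ι),
      α < (Measure.pi fun _ : ι => μ).real {z | ∀ j, ∃ i, ∀ k, z (e (i, k)) ∈ B j k} := by
  -- `q j` is the probability that a single row misses box j; the union bound below gives ∑ q j ^ M.
  let q : Fin N → ℝ := fun j => (1 - ∏ k, μ (B j k)).toReal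
  have hq : ∀ j, q j < 1 := by
    intro j
    have h1 : 1 - ∏ k, μ (B j k) < 1 :=
      ENNReal.sub_lt_self ENNReal.one_ne_top one_ne_zero
        (Finset.prod_ne_zero_iff.2 fun k _ => (hpos j k).ne')
    simpa [q] using (ENNReal.toReal_lt_toReal h1.ne_top ENNReal.one_ne_top).2 h1
  have hlim : Filter.Tendsto (fun M : ℕ => ∑ j, q j ^ M) Filter.atTop (nhds 0) := by
    simpa using tendsto_finsetSum Finset.univ fun j _ =>
      tendsto_pow_atTop_nhds_zero_of_lt_one (r := q j) ENNReal.toReal_nonneg (hq j)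
  obtain ⟨M, hM, hM0⟩ := ((hlim.eventually (gt_mem_nhds (sub_pos.2 hα))).and
    (Filter.eventually_gt_atTop 0)).exists
  refine ⟨M, hM0, fun ι _ e => ?_⟩
  have hmeas : MeasurableSet {z : ι → ℝ | ∀ j, ∃ i, ∀ k, z (e (i, k)) ∈ B j k} := by
    simp only [Set.ofPred_forall, Set.ofPred_exists]
    exact MeasurableSet.iInter fun j => MeasurableSet.iUnion fun i => MeasurableSet.iInter fun k =>
      measurable_pi_apply _ (hB j k)
  have hcompl : {z : ι → ℝ | ∀ j, ∃ i, ∀ k, z (e (i, k)) ∈ B j k}ᶜ =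
      ⋃ j, {z | ∀ i, ¬ ∀ k, z (e (i, k)) ∈ B j k} := by
    ext z
    simp
  have hle : (Measure.pi fun _ : ι => μ).real
      {z : ι → ℝ | ∀ j, ∃ i, ∀ k, z (e (i, k)) ∈ B j k}ᶜ ≤ ∑ j, q j ^ M := by
    rw [hcompl]
    refine (measureReal_iUnion_fintype_le _).trans (Finset.sum_le_sum fun j _ => ?_)
    rw [measureReal_def, pi_forall_row_notMem μ (B j) (hB j) e, ENNReal.toReal_pow]
  rw [probReal_compl_eq_one_sub hmeas] at hle
  linarith

end Probability

/-! ### Networks as sums of ridge functions, and the main theorem -/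

theorem featureNetworkOn_eq_sum {M d : ℕ} (K : TopologicalSpace.Compacts (Fin d → ℝ)) {σ : ℝ → ℝ}
    (hσ : Continuous σ) (A : Matrix (Fin M) (Fin d) ℝ) (ξ w : Fin M → ℝ) :
    featureNetworkOn K hσ A ξ w = ∑ i, w i • ridgeOn K ⟨σ, hσ⟩ (A i, ξ i) := by
  ext x
  simp only [featureNetworkOn, featureNetwork, ridgeOn, ContinuousMap.coe_mk, dotProduct,
    ContinuousMap.coe_sum, ContinuousMap.coe_smul, Finset.sum_apply, Pi.smul_apply, smul_eq_mul,
    Pi.add_apply, Matrix.mulVec]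

/-- Features selected by `i` (possibly with repetitions) can be realised by output weights. -/
theorem featureNetworkOn_sum_fiber {M d N : ℕ} (K : TopologicalSpace.Compacts (Fin d → ℝ))
    {σ : ℝ → ℝ} (hσ : Continuous σ) (A : Matrix (Fin M) (Fin d) ℝ) (ξ : Fin M → ℝ)
    (v : Fin N → ℝ) (i : Fin N → Fin M) :
    featureNetworkOn K hσ A ξ (fun m => ∑ j with i j = m, v j) =
      ∑ j, v j • ridgeOn K ⟨σ, hσ⟩ (A (i j), ξ (i j)) := by
  rw [featureNetworkOn_eq_sum, ← Finset.sum_fiberwise Finset.univ i]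
  refine Finset.sum_congr rfl fun m _ => ?_
  rw [Finset.sum_smul]
  refine Finset.sum_congr rfl fun j hj => ?_
  rw [(Finset.mem_filter.1 hj).2]

/-- The joint law of the entries is the product measure. -/
theorem HasIIDEntries.map_eq_pi {Ω : Type*} [MeasurableSpace Ω] {M d : ℕ}
    {A : Ω → Matrix (Fin M) (Fin d) ℝ} {ξ : Ω → Fin M → ℝ} {μ : Measure ℝ} {P : Measure Ω}
    [IsProbabilityMeasure P] (h : HasIIDEntries A ξ μ P) :
    P.map (fun ω k => randomEntries A ξ k ω) = Measure.pi fun _ => μ := by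
  rw [(iIndepFun_iff_map_fun_eq_pi_map fun k => (h.hasLaw k).aemeasurable).1 h.indep]
  simp_rw [(h.hasLaw _).map_eq]

theorem mainTheorem3 (d : ℕ) (K : TopologicalSpace.Compacts (Fin d → ℝ)) (f : C(K, ℝ))
    (σ : ℝ → ℝ) (hσ : Continuous σ) (hσ_poly : ¬ IsPolynomialFunction σ)
    (μ : Measure ℝ) [IsProbabilityMeasure μ] [NullSingletonClass μ] [μ.IsOpenPosMeasure]
    (α : ℝ) (hα : α ∈ Set.Ioo (0 : ℝ) 1) (ε : ℝ) (hε : 0 < ε) :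
    ∃ M : ℕ, 0 < M ∧
      ∀ (Ω : Type*) [MeasurableSpace Ω] (P : Measure Ω) [IsProbabilityMeasure P]
        (A : Ω → Matrix (Fin M) (Fin d) ℝ) (ξ : Ω → Fin M → ℝ),
        HasIIDEntries A ξ μ P →
          α < P.real {ω | ∃ w : Fin M → ℝ, ‖f - featureNetworkOn K hσ (A ω) (ξ ω) w‖ < ε} := by
  obtain ⟨N, v, θ, δ, hδ, hθ⟩ := exists_sum_ridgeOn_lt_of_mem_ball K ⟨σ, hσ⟩ hσ_poly f hε
  -- In the sup metric a parameter ball is a product of intervals, one per weight and one for the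
  -- bias.
  let B : Fin N → Fin d ⊕ Unit → Set ℝ := fun j =>
    Sum.elim (fun k => Metric.ball ((θ j).1 k) δ) fun _ => Metric.ball (θ j).2 δ
  have hBo : ∀ j k, IsOpen (B j k) := by
    rintro j (k | k) <;> exact Metric.isOpen_ball
  have hBpos : ∀ j k, 0 < μ (B j k) := by
    rintro j (k | k) <;> exact Metric.measure_ball_pos μ _ hδ
  obtain ⟨M, hM, hMα⟩ := exists_lt_pi_forall_exists_row_mem μ B
    (fun j k => (hBo j k).measurableSet) hBpos hα.2
  refine ⟨M, hM, fun Ω _ P _ A ξ h => ?_⟩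
  let e : Fin M × (Fin d ⊕ Unit) ≃ (Fin M × Fin d) ⊕ Fin M :=
    (Equiv.prodSumDistrib _ _ _).trans (Equiv.sumCongr (Equiv.refl _) (Equiv.prodPUnit _))
  refine (hMα _ e).trans_le ?_
  have hae : AEMeasurable (fun ω k => randomEntries A ξ k ω) P :=
    aemeasurable_pi_lambda _ fun k => (h.hasLaw k).aemeasurable
  rw [← h.map_eq_pi]
  have hmeas : MeasurableSet
      {z : (Fin M × Fin d) ⊕ Fin M → ℝ | ∀ j, ∃ i, ∀ k, z (e (i, k)) ∈ B j k} := by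
    simp only [Set.ofPred_forall, Set.ofPred_exists]
    exact MeasurableSet.iInter fun j => MeasurableSet.iUnion fun i => MeasurableSet.iInter fun k =>
      measurable_pi_apply _ (hBo j k).measurableSet
  rw [map_measureReal_apply_of_aemeasurable hae hmeas]
  -- Only inclusion of events is used, so the target event need not be measurable.
  refine measureReal_mono fun ω hω => ?_
  choose i hi using hω
  refine ⟨fun m => ∑ j with i j = m, v j, ?_⟩
  rw [featureNetworkOn_sum_fiber]
  refine hθ _ fun j => ?_
  rw [Metric.mem_ball, Prod.dist_eq, max_lt_iff, dist_pi_lt_iff hδ]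
  exact ⟨fun k => hi j (Sum.inl k), hi j (Sum.inr ())⟩
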